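/- Let $\mathcal A$ be a finite alphabet and $\eta\colon\mathbb Z^2\to\mathcal A$. For $\vec u\in\mathbb Z^2$ put $(T^{\vec u}f)(\vec x)=f(\vec x+\vec u)$. Give $\mathcal A$ the discrete topology, let $X_\eta$ be the closure of $\{T^{\vec u}\eta:\vec u\in\mathbb Z^2\}$ in the product topology on $\mathcal A^{\mathbb Z^2}$, and let $d$ be any metric on $X_\eta$ inducing its topology. For $\mathcal S\subseteq\mathbb Z^2$, an $\eta$-coloring of $\mathcal S$ is a function $(T^{\vec u}\eta)|_{\mathcal S}$ with $\vec u\in\mathbb Z^2$. For $n,k\ge1$, $P_\eta(n,k)$ is the number of distinct $\eta$-colorings of $\{0,\dots,n-1\}\times\{0,\dots,k-1\}$. For $\mathcal T\subseteq\mathcal S$, an $\eta$-coloring $\alpha$ of $\mathcal T$ extends uniquely to an $\eta$-coloring of $\mathcal S$ if there is exactly one $\eta$-coloring $\beta$ of $\mathcal S$ with $\beta|_{\mathcal T}=\alpha$. The coloring $\eta$ is doubly periodic if there are two linearly independent $\vec u,\vec v\in\mathbb Z^2$ with $T^{\vec u}\eta=T^{\vec v}\eta=\eta$. A linear subspace $V\subseteq\mathbb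 R^2$ is expansive if there are $r,\delta>0$ such that, for all $x,y\in X_\eta$, if $d(T^{\vec u}x,T^{\vec u}y)<\delta$ for every $\vec u\in\mathbb Z^2$ at Euclidean distance less than $r$ from $V$, then $x=y$; otherwise $V$ is nonexpansive. The oriented line spanned by $\vec v\in\mathbb Z^2\setminus\{\vec 0\}$ is one-sided $\eta$-expansive if there are integers $a,b\ge0$ and $M\in SL_2(\mathbb Z)$ such that $\vec v$ is a positive multiple of $M(0,-1)$ and every $(\eta\circ M)$-coloring of $[0,a]\times[-b,b]$ extends uniquely to an $(\eta\circ M)$-coloring of $[0,a]\times[-b,b]\cup\{(-1,0)\}$ (integer points); otherwise it is one-sided $\eta$-nonexpansive. Then: 1. $\eta$ is doubly periodic if and only if there exist integers $n,k\ge1$ such that $P_\eta(n,k)\le nk$ and there is no nonexpansive one-dimensional subspace of $\mathbb R^2$. 2. If there exist integers $n,k\ge1$ with $P_\eta(n,k)\le nk$, and there is either no nonexpansive one-dimensional subspace of $\mathbb R^2$ or no one-sided $\eta$-nonexpansive oriented line, then there is a finite set $F\subset\mathbb Z^2$ such that every $\eta$-coloring of $F$ extends uniquely to an $\eta$-coloring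 of $\mathbb Z^2$. -/

import Mathlib

namespace PlaneColoring

/-- The translation `(T^u f)(x) = f (x + u)` on colorings of `ℤ²`. -/
def shift {A : Type*} (u : ℤ × ℤ) (f : ℤ × ℤ → A) : ℤ × ℤ → A := fun x => f (x + u)

/-- The orbit `{T^u η : u ∈ ℤ²}`. -/
def orbit {A : Type*} (η : ℤ × ℤ → A) : Set (ℤ × ℤ → A) := Set.range fun u => shift u η

/-- `X_η`, the closure of the orbit of `η` in the product topology. -/
def orbitClosure {A : Type*} [TopologicalSpace A] (η : ℤ × ℤ → A) : Set (ℤ × ℤ → A) :=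
  closure (orbit η)

theorem shift_mem_orbitClosure {A : Type*} [TopologicalSpace A] (η : ℤ × ℤ → A) (u : ℤ × ℤ)
    {f : ℤ × ℤ → A} (hf : f ∈ orbitClosure η) : shift u f ∈ orbitClosure η := by
  have hc : Continuous (shift u : (ℤ × ℤ → A) → (ℤ × ℤ → A)) :=
    continuous_pi fun x => continuous_apply (x + u)
  refine map_mem_closure hc hf ?_
  rintro _ ⟨w, rfl⟩
  exact ⟨u + w, by funext x; simp [shift, add_assoc]⟩

/-- The action of `ℤ²` on `X_η` by translations. -/
def shiftAction {A : Type*} [TopologicalSpace A] (η : ℤ × ℤ → A) (u : ℤ × ℤ)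
    (f : orbitClosure η) : orbitClosure η :=
  ⟨shift u f.1, shift_mem_orbitClosure η u f.2⟩

/-- `u` is a period vector of `η` (the zero vector is allowed here). -/
def IsPeriodVector {A : Type*} (η : ℤ × ℤ → A) (u : ℤ × ℤ) : Prop := ∀ x, η (x + u) = η x

/-- `η` is doubly periodic: it has two linearly independent period vectors. -/
def DoublyPeriodic {A : Type*} (η : ℤ × ℤ → A) : Prop :=
  ∃ u v : ℤ × ℤ, IsPeriodVector η u ∧ IsPeriodVector η v ∧ LinearIndependent ℤ ![u, v]

/-- `W(S, η)`, the set of `η`-colorings of `S`: the restrictions to `S` of translates of `η`. -/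
def colorings {A : Type*} (η : ℤ × ℤ → A) (S : Set (ℤ × ℤ)) : Set (S → A) :=
  Set.range fun u => fun x : S => shift u η x

/-- The complexity `P_η(S)`, the number of `η`-colorings of `S`. -/
noncomputable def complexity {A : Type*} (η : ℤ × ℤ → A) (S : Set (ℤ × ℤ)) : ℕ∞ :=
  (colorings η S).encard

/-- The rectangle `R_{n,k} = {(x, y) : 0 ≤ x < n, 0 ≤ y < k}`. -/
def rectangle (n k : ℕ) : Set (ℤ × ℤ) := Set.Ico 0 (n : ℤ) ×ˢ Set.Ico 0 (k : ℤ)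

/-- Every `η`-coloring of `T` extends uniquely to an `η`-coloring of `S` (used for `T ⊆ S`). -/
def ExtendsUniquely {A : Type*} (η : ℤ × ℤ → A) (T S : Set (ℤ × ℤ)) : Prop :=
  ∀ α ∈ colorings η T, ∃! β : S → A, β ∈ colorings η S ∧
    ∀ (x : ℤ × ℤ) (hT : x ∈ T) (hS : x ∈ S), β ⟨x, hS⟩ = α ⟨x, hT⟩

/-- The inclusion of `ℤ²` in the Euclidean plane. -/
def toPlane (u : ℤ × ℤ) : EuclideanSpace ℝ (Fin 2) := !₂[(u.1 : ℝ), (u.2 : ℝ)]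

/-- Boyle and Lind's expansiveness of a subspace `V ⊆ ℝ²` for maps `T^u`, `u ∈ ℤ²`, on a metric
space `X`, with expansiveness radius `r` and expansiveness constant `δ`. -/
def IsExpansive {X : Type*} [MetricSpace X] (T : ℤ × ℤ → X → X)
    (V : Submodule ℝ (EuclideanSpace ℝ (Fin 2))) : Prop :=
  ∃ r > (0 : ℝ), ∃ δ > (0 : ℝ), ∀ x y : X,
    (∀ u : ℤ × ℤ, Metric.infDist (toPlane u) (V : Set (EuclideanSpace ℝ (Fin 2))) < r →
      dist (T u x) (T u y) < δ) → x = y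

/-- For the translation action on `X_η`, with the metric `m` on `X_η`, there is a nonexpansive
one-dimensional subspace of `ℝ²`. -/
def HasNonexpansiveLine {A : Type*} [TopologicalSpace A] (η : ℤ × ℤ → A)
    (m : MetricSpace (orbitClosure η)) : Prop :=
  ∃ V : Submodule ℝ (EuclideanSpace ℝ (Fin 2)), Module.finrank ℝ V = 1 ∧
    ¬ @IsExpansive (orbitClosure η) m (shiftAction η) V

/-- The linear action of a matrix in `SL₂(ℤ)` on `ℤ²` (column vectors). -/
def slMap (M : Matrix.SpecialLinearGroup (Fin 2) ℤ) (u : ℤ × ℤ) : ℤ × ℤ :=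
  (M.1 0 0 * u.1 + M.1 0 1 * u.2, M.1 1 0 * u.1 + M.1 1 1 * u.2)

/-- The oriented rational line spanned by `v ∈ ℤ² \ {0}` is one-sided `η`-expansive: for some
`a, b` and some `M ∈ SL₂(ℤ)` mapping the downward oriented `y`-axis to it, every
`(η ∘ M)`-coloring of `[0,a] × [-b,b]` extends uniquely to `[0,a] × [-b,b] ∪ {(-1,0)}`. -/
def OneSidedExpansive {A : Type*} (η : ℤ × ℤ → A) (v : ℤ × ℤ) : Prop :=
  ∃ (a b : ℕ) (M : Matrix.SpecialLinearGroup (Fin 2) ℤ),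
    (∃ c : ℕ, 0 < c ∧ v = c • slMap M (0, -1)) ∧
    ExtendsUniquely (η ∘ slMap M)
      (Set.Icc 0 (a : ℤ) ×ˢ Set.Icc (-(b : ℤ)) (b : ℤ))
      ((Set.Icc 0 (a : ℤ) ×ˢ Set.Icc (-(b : ℤ)) (b : ℤ)) ∪ {((-1 : ℤ), (0 : ℤ))})

/-- Some oriented rational line through the origin is one-sided `η`-nonexpansive. -/
def HasOneSidedNonexpansiveDirection {A : Type*} (η : ℤ × ℤ → A) : Prop :=
  ∃ v : ℤ × ℤ, v ≠ 0 ∧ ¬ OneSidedExpansive η v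

end PlaneColoring

/-!
The heart of the matter is a two-dimensional case of a theorem of Boyle and Lind. If `X_η` is
infinite, then by pigeonhole it contains, for every `n`, two distinct points that agree on the box
of radius `n`. Move the first site where they differ, in the order of Euclidean distance from the
origin, to the origin: the two points then agree on an open disc of radius at least `n` whose
boundary circle passes through the origin. As `n → ∞` the discs exhaust an open half-plane, and
compactness yields `x, y ∈ X_η` that differ at `0` but agree on all `z` with `⟪u, z⟫ < 0`, for some
`u ≠ 0` (`exists_halfPlane_pair`).

* Such a pair, translated so that it agrees far beyond the line `u^⊥`, shows that `u^⊥` is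
  nonexpansive (`not_isExpansive_of_halfPlane_pair`).
* If `u^⊥` contains a nonzero integer vector, such a pair shows that one of the two orientations of
  `u^⊥` is one-sided nonexpansive (`exists_not_oneSidedExpansive_of_halfPlane_pair`).
* If `u^⊥` contains no nonzero integer vector, then `⟪u, ·⟫` is injective on `ℤ²`. Build up the
  `n × k` rectangle by adding its points in increasing order of `⟪u, ·⟫`. If the complexity grew at
  every step, it would end above `n * k`; so if `P_η(n, k) ≤ n * k`, the color at some point is
  determined by the colors at the lower points of the rectangle
  (`exists_determined_of_complexity_le_card`), and no such pair exists.

So either alternative of the second claim makes `X_η` finite. Finally, `X_η` is finite exactly when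
`η` is doubly periodic, every line is then expansive (nearness at `u = 0` alone separates the
points), and a finite set of sites separates the finitely many translates of `η`.
-/

namespace PlaneColoring

open Filter Topology

variable {A : Type*}

/-! ### The linear form attached to a direction -/

/-- The inner product `⟪u, z⟫` of a real vector `u` with a lattice point `z`. -/
def pairing (u : ℝ × ℝ) (z : ℤ × ℤ) : ℝ := u.1 * z.1 + u.2 * z.2

theorem pairing_add (u : ℝ × ℝ) (z w : ℤ × ℤ) : pairing u (z + w) = pairing u z + pairing u w := by
  simp only [pairing, Prod.fst_add, Prod.snd_add]; push_cast; ring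

theorem pairing_neg (u : ℝ × ℝ) (z : ℤ × ℤ) : pairing u (-z) = -pairing u z := by
  simp only [pairing, Prod.fst_neg, Prod.snd_neg]; push_cast; ring

theorem pairing_sub (u : ℝ × ℝ) (z w : ℤ × ℤ) : pairing u (z - w) = pairing u z - pairing u w := by
  rw [sub_eq_add_neg, pairing_add, pairing_neg, sub_eq_add_neg]

theorem pairing_nsmul (u : ℝ × ℝ) (n : ℕ) (z : ℤ × ℤ) :
    pairing u (n • z) = n * pairing u z := by
  simp only [pairing, Prod.smul_fst, Prod.smul_snd]; push_cast [nsmul_eq_mul]; ring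

theorem pairing_slMap (u : ℝ × ℝ) (M : Matrix.SpecialLinearGroup (Fin 2) ℤ) (z : ℤ × ℤ) :
    pairing u (slMap M z) =
      z.1 * (u.1 * M.1 0 0 + u.2 * M.1 1 0) + z.2 * (u.1 * M.1 0 1 + u.2 * M.1 1 1) := by
  simp only [pairing, slMap]; push_cast; ring

theorem exists_pairing_lt {u : ℝ × ℝ} (hu : u ≠ 0) (C : ℝ) : ∃ s : ℤ × ℤ, pairing u s < C := by
  obtain ⟨s, hs⟩ : ∃ s : ℤ × ℤ, pairing u s < 0 := by
    by_contra! h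
    have h1 := h (1, 0)
    have h2 := h (-1, 0)
    have h3 := h (0, 1)
    have h4 := h (0, -1)
    simp only [pairing] at h1 h2 h3 h4
    norm_num at h1 h2 h3 h4
    exact hu (Prod.ext (le_antisymm h2 h1) (le_antisymm h4 h3))
  obtain ⟨n, hn⟩ := exists_nat_gt (-C / -pairing u s)
  refine ⟨n • s, ?_⟩
  rw [div_lt_iff₀ (by linarith)] at hn
  rw [pairing_nsmul]
  linarith

/-! ### Finite patterns of points of the orbit closure -/

theorem exists_eq_translate [TopologicalSpace A] [DiscreteTopology A] {η f : ℤ × ℤ → A}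
    (hf : f ∈ orbitClosure η) {S : Set (ℤ × ℤ)} (hS : S.Finite) :
    ∃ u : ℤ × ℤ, ∀ z ∈ S, f z = η (z + u) := by
  have ho : IsOpen (S.pi fun z => ({f z} : Set A)) :=
    isOpen_set_pi hS fun _ _ => isOpen_discrete _
  obtain ⟨_, hg, u, rfl⟩ := mem_closure_iff.1 hf _ ho fun z _ => rfl
  exact ⟨u, fun z hz => (hg z hz).symm⟩

theorem complexity_eq_ncard [Finite A] (η : ℤ × ℤ → A) {S : Set (ℤ × ℤ)} (hS : S.Finite) :
    complexity η S = (colorings η S).ncard := by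
  have := hS.to_subtype
  exact (Set.toFinite (colorings η S)).cast_ncard_eq.symm

/-- If each point of `s` has a color that is not determined by the colors at the lower points of
`s`, then the complexity increases strictly with each point added from the bottom up. -/
theorem card_lt_ncard_colorings [Finite A] (η : ℤ × ℤ → A) {ℓ : ℤ × ℤ → ℝ}
    (hℓ : Function.Injective ℓ) (s : Finset (ℤ × ℤ))
    (h : ∀ p ∈ s, ∃ u v, (∀ q ∈ s, ℓ q < ℓ p → η (q + u) = η (q + v)) ∧ η (p + u) ≠ η (p + v)) :
    s.card < (colorings η (s : Set (ℤ × ℤ))).ncard := by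
  induction s using Finset.induction_on_max_value ℓ with
  | empty =>
    rw [Finset.card_empty, Set.ncard_pos (Set.toFinite _)]
    exact Set.range_nonempty _
  | insert a s ha hmax ih =>
    have ih' := ih fun p hp => by
      obtain ⟨u, v, h1, h2⟩ := h p (Finset.mem_insert_of_mem hp)
      exact ⟨u, v, fun q hq => h1 q (Finset.mem_insert_of_mem hq), h2⟩
    have hsub : (s : Set (ℤ × ℤ)) ⊆ ((insert a s : Finset (ℤ × ℤ)) : Set (ℤ × ℤ)) :=
      Finset.coe_subset.2 (Finset.subset_insert a s)
    let ρ : (↥((insert a s : Finset (ℤ × ℤ)) : Set (ℤ × ℤ)) → A) → ↥(s : Set (ℤ × ℤ)) → A :=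
      fun β x => β ⟨x.1, hsub x.2⟩
    have himg : ρ '' colorings η ((insert a s : Finset (ℤ × ℤ)) : Set (ℤ × ℤ)) =
        colorings η (s : Set (ℤ × ℤ)) := by
      rw [colorings, ← Set.range_comp]; rfl
    have hle := Set.ncard_image_le (f := ρ)
      (Set.toFinite (colorings η ((insert a s : Finset (ℤ × ℤ)) : Set (ℤ × ℤ))))
    rw [himg] at hle
    rw [Finset.card_insert_of_notMem ha]
    refine Nat.lt_of_le_of_lt ih' (lt_of_le_of_ne hle fun heq => ?_)
    have hinj : Set.InjOn ρ (colorings η ((insert a s : Finset (ℤ × ℤ)) : Set (ℤ × ℤ))) :=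
      Set.injOn_of_ncard_image_eq (by rw [himg, heq]) (Set.toFinite _)
    obtain ⟨u, v, h1, h2⟩ := h a (Finset.mem_insert_self a s)
    refine h2 ?_
    have := hinj ⟨u, rfl⟩ ⟨v, rfl⟩ (funext fun x => h1 x.1 (Finset.mem_insert_of_mem x.2) <|
      lt_of_le_of_ne (hmax x.1 x.2) fun he => ha (hℓ he ▸ x.2))
    exact congrFun this ⟨a, Finset.mem_insert_self a s⟩

theorem exists_determined_of_complexity_le_card [Finite A] (η : ℤ × ℤ → A) {ℓ : ℤ × ℤ → ℝ}
    (hℓ : Function.Injective ℓ) {s : Finset (ℤ × ℤ)}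
    (hs : complexity η (s : Set (ℤ × ℤ)) ≤ s.card) :
    ∃ p ∈ s, ∀ u v, (∀ q ∈ s, ℓ q < ℓ p → η (q + u) = η (q + v)) → η (p + u) = η (p + v) := by
  by_contra! h
  rw [complexity_eq_ncard η s.finite_toSet, Nat.cast_le] at hs
  exact hs.not_gt (card_lt_ncard_colorings η hℓ s h)

/-- Unique extension of `η`-colorings from `T` to a finite set `S` passes to all of `X_η`. -/
theorem ExtendsUniquely.eq_of_eqOn [TopologicalSpace A] [DiscreteTopology A] {η f g : ℤ × ℤ → A}
    {T S : Set (ℤ × ℤ)} (h : ExtendsUniquely η T S) (hS : S.Finite)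
    (hf : f ∈ orbitClosure η) (hg : g ∈ orbitClosure η) (hfg : ∀ z ∈ T, f z = g z) :
    ∀ z ∈ S, f z = g z := by
  obtain ⟨u, hu⟩ := exists_eq_translate hf hS
  obtain ⟨v, hv⟩ := exists_eq_translate hg hS
  obtain ⟨β, -, hβ⟩ := h _ ⟨u, rfl⟩
  have h1 := hβ (fun x => shift u η x) ⟨⟨u, rfl⟩, fun _ _ _ => rfl⟩
  have h2 := hβ (fun x => shift v η x) ⟨⟨v, rfl⟩, fun x hT hS => by
    change η (x + v) = η (x + u)
    rw [← hu x hS, ← hv x hS, hfg x hT]⟩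
  intro z hz
  rw [hu z hz, hv z hz]
  exact congrFun (h1.trans h2.symm) ⟨z, hz⟩

/-! ### Pairs of points that agree on a half-plane -/

/-- `x` and `y` differ at the origin and agree on the open half-plane `⟪u, z⟫ < 0`. -/
structure IsHalfPlanePair (u : ℝ × ℝ) (x y : ℤ × ℤ → A) : Prop where
  ne_zero : u ≠ 0
  apply_ne : x 0 ≠ y 0
  eq_of_neg : ∀ z, pairing u z < 0 → x z = y z

/-- An infinite `X_η` contains two points that differ at the origin and agree on a large disc
through the origin with center `-p`: the last condition says that `z + p` is closer to the origin
than `p` in Euclidean distance, whereas the norm bounding `p` from below is the maximum norm. -/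
theorem exists_disc_pair [Finite A] [TopologicalSpace A] {η : ℤ × ℤ → A}
    (hX : (orbitClosure η).Infinite) (n : ℕ) :
    ∃ x ∈ orbitClosure η, ∃ y ∈ orbitClosure η, ∃ p : ℤ × ℤ,
      (n : ℝ) < ‖((p.1 : ℝ), (p.2 : ℝ))‖ ∧ x 0 ≠ y 0 ∧
      ∀ z : ℤ × ℤ, z.1 ^ 2 + z.2 ^ 2 + 2 * (p.1 * z.1 + p.2 * z.2) < 0 → x z = y z := by
  let B : Set (ℤ × ℤ) := Set.Icc (-(n : ℤ)) n ×ˢ Set.Icc (-(n : ℤ)) n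
  have hB : B.Finite := (Set.finite_Icc _ _).prod (Set.finite_Icc _ _)
  have := hB.to_subtype
  obtain ⟨f, hf, g, hg, hne, hfg⟩ := hX.exists_ne_map_eq_of_mapsTo
    (f := fun f (z : B) => f z.1) (Set.mapsTo_univ _ _) Set.finite_univ
  let N : ℤ × ℤ → ℕ := fun z => (z.1 ^ 2 + z.2 ^ 2).toNat
  have hD : {z | f z ≠ g z}.Nonempty := Function.ne_iff.1 hne
  let p := Function.argminOn N {z | f z ≠ g z} hD
  have hp : f p ≠ g p := Function.argminOn_mem N _ hD
  refine ⟨shift p f, shift_mem_orbitClosure η p hf, shift p g, shift_mem_orbitClosure η p hg, p,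
    ?_, by simpa [shift] using hp, fun z hz => ?_⟩
  · by_contra! hle
    rw [Prod.norm_mk, max_le_iff, Real.norm_eq_abs, Real.norm_eq_abs, abs_le, abs_le] at hle
    refine hp (congrFun hfg ⟨p, ?_⟩)
    exact ⟨⟨by exact_mod_cast hle.1.1, by exact_mod_cast hle.1.2⟩,
      ⟨by exact_mod_cast hle.2.1, by exact_mod_cast hle.2.2⟩⟩
  · by_contra hzne
    have hmin : N p ≤ N (z + p) := Function.argminOn_le N {z | f z ≠ g z} hzne
    have h0 : (0 : ℤ) ≤ (z + p).1 ^ 2 + (z + p).2 ^ 2 := by positivity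
    have : p.1 ^ 2 + p.2 ^ 2 ≤ (z + p).1 ^ 2 + (z + p).2 ^ 2 := by
      simp only [N] at hmin
      omega
    simp only [Prod.fst_add, Prod.snd_add] at this
    nlinarith

theorem isCompact_orbitClosure [Finite A] [TopologicalSpace A] (η : ℤ × ℤ → A) :
    IsCompact (orbitClosure η) := isClosed_closure.isCompact

theorem exists_halfPlane_pair [Finite A] [TopologicalSpace A] [DiscreteTopology A]
    {η : ℤ × ℤ → A} (hX : (orbitClosure η).Infinite) :
    ∃ u, ∃ x ∈ orbitClosure η, ∃ y ∈ orbitClosure η, IsHalfPlanePair u x y := by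
  choose x hx y hy p hp h0 hxy using exists_disc_pair hX
  let P : ℕ → ℝ × ℝ := fun n => (((p n).1 : ℝ), ((p n).2 : ℝ))
  have hPpos : ∀ n, 0 < ‖P n‖ := fun n => (Nat.cast_nonneg n).trans_lt (hp n)
  let e : ℕ → ℝ × ℝ := fun n => ‖P n‖⁻¹ • P n
  have he : ∀ n, e n ∈ Metric.sphere (0 : ℝ × ℝ) 1 := fun n => by
    rw [mem_sphere_zero_iff_norm, norm_smul, norm_inv, norm_norm,
      inv_mul_cancel₀ (hPpos n).ne']
  let 𝒰 : Ultrafilter ℕ := hyperfilter ℕ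
  have h𝒰 : (𝒰 : Filter ℕ) ≤ atTop := Nat.hyperfilter_le_atTop
  obtain ⟨x', hx', hxlim⟩ := (isCompact_orbitClosure η).ultrafilter_le_nhds' (𝒰.map x)
    (Ultrafilter.mem_map.2 (univ_mem' hx))
  obtain ⟨y', hy', hylim⟩ := (isCompact_orbitClosure η).ultrafilter_le_nhds' (𝒰.map y)
    (Ultrafilter.mem_map.2 (univ_mem' hy))
  obtain ⟨u, hu, hulim⟩ := (isCompact_sphere (0 : ℝ × ℝ) 1).ultrafilter_le_nhds' (𝒰.map e)
    (Ultrafilter.mem_map.2 (univ_mem' he))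
  have hxe : ∀ z, ∀ᶠ n in (𝒰 : Filter ℕ), x n z = x' z := fun z =>
    (((continuous_apply z).tendsto x').comp (show Tendsto x 𝒰 (𝓝 x') from hxlim)).eventually
      (by rw [nhds_discrete]; exact mem_pure.2 rfl : ∀ᶠ a in 𝓝 (x' z), a = x' z)
  have hye : ∀ z, ∀ᶠ n in (𝒰 : Filter ℕ), y n z = y' z := fun z =>
    (((continuous_apply z).tendsto y').comp (show Tendsto y 𝒰 (𝓝 y') from hylim)).eventually
      (by rw [nhds_discrete]; exact mem_pure.2 rfl : ∀ᶠ a in 𝓝 (y' z), a = y' z)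
  have hue : Tendsto e 𝒰 (𝓝 u) := hulim
  refine ⟨u, x', hx', y', hy', ?_, ?_, fun z hz => ?_⟩
  · rintro rfl
    simp at hu
  · obtain ⟨n, h1, h2⟩ := ((hxe 0).and (hye 0)).exists
    rw [← h1, ← h2]
    exact h0 n
  · -- After division by `‖p‖`, the condition on `z` becomes, in the limit, `2 * ⟪u, z⟫ < 0`.
    have hinv : Tendsto (fun n => ‖P n‖⁻¹) 𝒰 (𝓝 0) :=
      (tendsto_inv_atTop_zero.comp (tendsto_atTop_mono (fun n => (hp n).le)
        tendsto_natCast_atTop_atTop)).mono_left h𝒰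
    have hlim : Tendsto (fun n => ‖P n‖⁻¹ * ((z.1 : ℝ) ^ 2 + (z.2 : ℝ) ^ 2) +
        2 * ((e n).1 * z.1 + (e n).2 * z.2)) 𝒰
        (𝓝 (0 * ((z.1 : ℝ) ^ 2 + (z.2 : ℝ) ^ 2) + 2 * (u.1 * z.1 + u.2 * z.2))) :=
      (hinv.mul_const _).add ((((hue.fst_nhds).mul_const _).add
        ((hue.snd_nhds).mul_const _)).const_mul 2)
    have hneg := hlim.eventually_lt_const (u := 0) (by simp only [pairing] at hz; linarith)
    obtain ⟨n, h1, h2, h3⟩ := ((hxe z).and ((hye z).and hneg)).exists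
    rw [← h1, ← h2]
    refine hxy n z ?_
    have h4 : ‖P n‖⁻¹ * ((z.1 : ℝ) ^ 2 + (z.2 : ℝ) ^ 2 +
        2 * ((p n).1 * z.1 + (p n).2 * z.2)) < 0 := by
      refine lt_of_eq_of_lt ?_ h3
      simp only [e, P, Prod.smul_mk, smul_eq_mul]
      ring
    have h5 := (pos_iff_neg_of_mul_neg h4).1 (inv_pos.2 (hPpos n))
    exact_mod_cast h5

/-! ### Nonexpansive lines -/

/-- On a compact metric space, a family of continuous maps to discrete spaces that separates points
controls the metric up to `δ` through finitely many of its members. -/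
theorem exists_finset_forall_dist_lt {X ι : Type*} [MetricSpace X] [CompactSpace X]
    [TopologicalSpace A] [DiscreteTopology A] {c : ι → X → A} (hc : ∀ i, Continuous (c i))
    (hsep : ∀ x y, (∀ i, c i x = c i y) → x = y) {δ : ℝ} (hδ : 0 < δ) :
    ∃ F : Finset ι, ∀ x y, (∀ i ∈ F, c i x = c i y) → dist x y < δ := by
  have hK : IsCompact {q : X × X | δ ≤ dist q.1 q.2} :=
    (isClosed_le continuous_const (continuous_fst.dist continuous_snd)).isCompact
  obtain ⟨F, hF⟩ := hK.elim_finite_subcover (fun i => {q : X × X | c i q.1 ≠ c i q.2})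
    (fun i => isOpen_ne_fun ((hc i).comp continuous_fst) ((hc i).comp continuous_snd))
    (fun q hq => by
      by_contra hcon
      simp only [Set.mem_iUnion, Set.mem_ofPred_eq, not_exists, not_not] at hcon
      have := hsep _ _ hcon
      simp only [Set.mem_ofPred_eq, this, dist_self] at hq
      exact hq.not_gt hδ)
  refine ⟨F, fun x y h => ?_⟩
  by_contra! hle
  have := hF (show (x, y) ∈ _ from hle)
  simp only [Set.mem_iUnion, Set.mem_ofPred_eq] at this
  obtain ⟨i, hi, hne⟩ := this
  exact hne (h i hi)

theorem exists_finset_forall_dist_orbitClosure_lt [Finite A] [TopologicalSpace A]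
    [DiscreteTopology A] {η : ℤ × ℤ → A} (m : MetricSpace (orbitClosure η))
    (hm : m.toUniformSpace.toTopologicalSpace =
      (instTopologicalSpaceSubtype : TopologicalSpace (orbitClosure η)))
    {δ : ℝ} (hδ : 0 < δ) :
    ∃ F : Finset (ℤ × ℤ), ∀ x y : orbitClosure η,
      (∀ z ∈ F, x.1 z = y.1 z) → m.dist x y < δ := by
  have hK : @CompactSpace _ m.toUniformSpace.toTopologicalSpace := by
    rw [hm]; exact isCompact_iff_compactSpace.1 (isCompact_orbitClosure η)
  refine @exists_finset_forall_dist_lt A (orbitClosure η) (ℤ × ℤ) m hK _ _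
    (fun z x => x.1 z) (fun z => ?_) (fun x y h => Subtype.ext (funext h)) δ hδ
  rw [hm]
  exact (continuous_apply z).comp continuous_subtype_val

/-- The line `u^⊥`, given by the spanning vector `(-u₂, u₁)`. -/
noncomputable def orthogonalLine (u : ℝ × ℝ) : Submodule ℝ (EuclideanSpace ℝ (Fin 2)) :=
  ℝ ∙ (!₂[-u.2, u.1] : EuclideanSpace ℝ (Fin 2))

theorem finrank_orthogonalLine {u : ℝ × ℝ} (hu : u ≠ 0) :
    Module.finrank ℝ (orthogonalLine u) = 1 := by
  refine finrank_span_singleton fun h => hu ?_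
  have h0 := congrFun (congrArg WithLp.ofLp h) 0
  have h1 := congrFun (congrArg WithLp.ofLp h) 1
  simp at h0 h1
  exact Prod.ext h1 h0

theorem pairing_le_of_infDist_lt (u : ℝ × ℝ) {z : ℤ × ℤ} {r : ℝ}
    (h : Metric.infDist (toPlane z) (orthogonalLine u : Set (EuclideanSpace ℝ (Fin 2))) < r) :
    pairing u z ≤ (|u.1| + |u.2|) * r := by
  obtain ⟨w, hw, hd⟩ := (Metric.infDist_lt_iff ⟨0, (orthogonalLine u).zero_mem⟩).1 h
  obtain ⟨t, rfl⟩ := Submodule.mem_span_singleton.1 hw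
  rw [dist_eq_norm] at hd
  have h0 := (PiLp.norm_apply_le _ (0 : Fin 2)).trans hd.le
  have h1 := (PiLp.norm_apply_le _ (1 : Fin 2)).trans hd.le
  simp only [toPlane, PiLp.sub_apply, PiLp.smul_apply, Real.norm_eq_abs, smul_eq_mul] at h0 h1
  simp at h0 h1
  calc pairing u z = u.1 * (z.1 + t * u.2) + u.2 * (z.2 - t * u.1) := by
        simp only [pairing]; ring
    _ ≤ |u.1| * |z.1 + t * u.2| + |u.2| * |z.2 - t * u.1| := by
        rw [← abs_mul, ← abs_mul]; exact add_le_add (le_abs_self _) (le_abs_self _)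
    _ ≤ |u.1| * r + |u.2| * r := by gcongr
    _ = _ := by ring

theorem not_isExpansive_of_halfPlane_pair [Finite A] [TopologicalSpace A] [DiscreteTopology A]
    {η : ℤ × ℤ → A} (m : MetricSpace (orbitClosure η))
    (hm : m.toUniformSpace.toTopologicalSpace =
      (instTopologicalSpaceSubtype : TopologicalSpace (orbitClosure η)))
    {u : ℝ × ℝ} {x y : ℤ × ℤ → A} (hx : x ∈ orbitClosure η) (hy : y ∈ orbitClosure η)
    (h : IsHalfPlanePair u x y) :
    ¬ @IsExpansive (orbitClosure η) m (shiftAction η) (orthogonalLine u) := by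
  rintro ⟨r, -, δ, hδ, hexp⟩
  obtain ⟨F, hF⟩ := exists_finset_forall_dist_orbitClosure_lt m hm hδ
  obtain ⟨C, hC⟩ := (F.finite_toSet.image (pairing u)).bddAbove
  -- Translate the pair so that it agrees on the window `F` placed anywhere in the `r`-strip.
  obtain ⟨s, hs⟩ := exists_pairing_lt h.ne_zero (-(C + (|u.1| + |u.2|) * r))
  have heq := hexp (shiftAction η s ⟨x, hx⟩) (shiftAction η s ⟨y, hy⟩) fun z hz => hF _ _ fun q hq =>
    h.eq_of_neg (q + z + s) (by
      have h1 := hC ⟨q, hq, rfl⟩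
      have h2 := pairing_le_of_infDist_lt u hz
      rw [pairing_add, pairing_add]
      linarith)
  have h0 := congrFun (congrArg Subtype.val heq) (-s)
  simp only [shiftAction, shift, neg_add_cancel] at h0
  exact h.apply_ne h0

/-! ### One-sided nonexpansive directions -/

theorem slMap_add (M : Matrix.SpecialLinearGroup (Fin 2) ℤ) (z w : ℤ × ℤ) :
    slMap M (z + w) = slMap M z + slMap M w := by
  ext <;> simp only [slMap, Prod.fst_add, Prod.snd_add] <;> ring

theorem det_eq_one (M : Matrix.SpecialLinearGroup (Fin 2) ℤ) :
    M.1 0 0 * M.1 1 1 - M.1 0 1 * M.1 1 0 = 1 := by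
  have := M.2
  rwa [Matrix.det_fin_two] at this

theorem slMap_surjective (M : Matrix.SpecialLinearGroup (Fin 2) ℤ) :
    Function.Surjective (slMap M) := fun z => by
  have hd := det_eq_one M
  refine ⟨(M.1 1 1 * z.1 - M.1 0 1 * z.2, M.1 0 0 * z.2 - M.1 1 0 * z.1), ?_⟩
  ext <;> simp only [slMap]
  · linear_combination z.1 * hd
  · linear_combination z.2 * hd

theorem comp_slMap_mem_orbitClosure [TopologicalSpace A] {η f : ℤ × ℤ → A}
    (M : Matrix.SpecialLinearGroup (Fin 2) ℤ) (hf : f ∈ orbitClosure η) :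
    f ∘ slMap M ∈ orbitClosure (η ∘ slMap M) := by
  have hc : Continuous fun g : ℤ × ℤ → A => g ∘ slMap M :=
    continuous_pi fun z => continuous_apply (slMap M z)
  refine map_mem_closure (f := fun g : ℤ × ℤ → A => g ∘ slMap M) hc hf ?_
  rintro _ ⟨w, rfl⟩
  obtain ⟨v, rfl⟩ := slMap_surjective M w
  exact ⟨v, by funext z; simp [shift, slMap_add]⟩

/-- The half-plane `⟪u, z⟫ < 0` lies on a definite side of the oriented line spanned by `w ∈ u^⊥`;
the sign of `det (u, w)` says on which one, and here it is the side on which the colors are assumed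
to determine those on the line. -/
theorem not_oneSidedExpansive_of_det_pos [TopologicalSpace A] [DiscreteTopology A]
    {η : ℤ × ℤ → A} {u : ℝ × ℝ} {x y : ℤ × ℤ → A} (hx : x ∈ orbitClosure η)
    (hy : y ∈ orbitClosure η) (h : IsHalfPlanePair u x y) {w : ℤ × ℤ} (hw : pairing u w = 0)
    (hdet : 0 < u.1 * w.2 - u.2 * w.1) : ¬ OneSidedExpansive η w := by
  rintro ⟨a, b, M, ⟨c, hc, rfl⟩, hext⟩
  have hc' : (0 : ℝ) < c := Nat.cast_pos.2 hc
  have hd : (M.1 0 0 * M.1 1 1 - M.1 0 1 * M.1 1 0 : ℝ) = 1 := by exact_mod_cast det_eq_one M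
  rw [pairing_nsmul, pairing_slMap] at hw
  have hcol : u.1 * M.1 0 1 + u.2 * M.1 1 1 = 0 := by
    have := (mul_eq_zero.1 hw).resolve_left hc'.ne'
    push_cast at this
    linarith
  simp only [slMap, Prod.smul_fst, Prod.smul_snd] at hdet
  push_cast [nsmul_eq_mul] at hdet
  have hcol' : 0 < u.2 * M.1 0 1 - u.1 * M.1 1 1 := by
    refine (pos_iff_pos_of_mul_pos (a := (c : ℝ)) ?_).1 hc'
    calc (0 : ℝ) < _ := hdet
      _ = _ := by ring
  -- `t` is the pairing of `u` with the first column of `M`. Solving `hcol` gives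
  -- `u = t • (M₁₁, -M₀₁)`, hence `hcol'` reads `0 < -t * (M₀₁ ^ 2 + M₁₁ ^ 2)`.
  set t : ℝ := u.1 * M.1 0 0 + u.2 * M.1 1 0 with ht
  have hu1 : u.1 = t * M.1 1 1 := by rw [ht]; linear_combination (-u.1) * hd - M.1 1 0 * hcol
  have hu2 : u.2 = -t * M.1 0 1 := by rw [ht]; linear_combination (-u.2) * hd + M.1 0 0 * hcol
  have htneg : t < 0 := by
    rw [hu1, hu2] at hcol'
    nlinarith [sq_nonneg (M.1 0 1 : ℝ), sq_nonneg (M.1 1 1 : ℝ)]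
  have hpair : ∀ z, pairing u (slMap M z) = z.1 * t := fun z => by
    rw [pairing_slMap, hcol]; ring
  have hfin : ((Set.Icc 0 (a : ℤ) ×ˢ Set.Icc (-(b : ℤ)) (b : ℤ)) ∪
      {((-1 : ℤ), (0 : ℤ))}).Finite :=
    ((Set.finite_Icc _ _).prod (Set.finite_Icc _ _)).union (Set.finite_singleton _)
  have key := hext.eq_of_eqOn hfin
    (shift_mem_orbitClosure _ (1, 0) (comp_slMap_mem_orbitClosure M hx))
    (shift_mem_orbitClosure _ (1, 0) (comp_slMap_mem_orbitClosure M hy))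
    (fun z hz => h.eq_of_neg _ (by
      rw [hpair]
      refine mul_neg_of_pos_of_neg ?_ htneg
      have : (0 : ℤ) ≤ z.1 := hz.1.1
      simp only [Prod.fst_add]
      exact_mod_cast (by omega : 0 < z.1 + 1)))
    (-1, 0) (Or.inr rfl)
  refine h.apply_ne ?_
  simpa [shift, slMap, Prod.mk_zero_zero] using key

theorem exists_not_oneSidedExpansive_of_halfPlane_pair [TopologicalSpace A] [DiscreteTopology A]
    {η : ℤ × ℤ → A} {u : ℝ × ℝ} {x y : ℤ × ℤ → A} (hx : x ∈ orbitClosure η)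
    (hy : y ∈ orbitClosure η) (h : IsHalfPlanePair u x y) {w : ℤ × ℤ} (hw0 : w ≠ 0)
    (hw : pairing u w = 0) : HasOneSidedNonexpansiveDirection η := by
  have hdet : u.1 * w.2 - u.2 * w.1 ≠ 0 := by
    intro hd
    -- Otherwise `u` is both orthogonal and parallel to `w`, so that `‖w‖² • u = 0`.
    have hpos : (0 : ℝ) < (w.1 : ℝ) ^ 2 + (w.2 : ℝ) ^ 2 := by
      by_contra! hle
      have h1 : (w.1 : ℝ) ^ 2 = 0 := by nlinarith [sq_nonneg (w.1 : ℝ), sq_nonneg (w.2 : ℝ)]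
      have h2 : (w.2 : ℝ) ^ 2 = 0 := by nlinarith [sq_nonneg (w.1 : ℝ), sq_nonneg (w.2 : ℝ)]
      exact hw0 (Prod.ext (by exact_mod_cast pow_eq_zero_iff two_ne_zero |>.1 h1)
        (by exact_mod_cast pow_eq_zero_iff two_ne_zero |>.1 h2))
    simp only [pairing] at hw
    refine h.ne_zero (Prod.ext ?_ ?_)
    · refine (mul_eq_zero.1 (?_ : u.1 * ((w.1 : ℝ) ^ 2 + (w.2 : ℝ) ^ 2) = 0)).resolve_right hpos.ne'
      linear_combination w.1 * hw + w.2 * hd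
    · refine (mul_eq_zero.1 (?_ : u.2 * ((w.1 : ℝ) ^ 2 + (w.2 : ℝ) ^ 2) = 0)).resolve_right hpos.ne'
      linear_combination w.2 * hw - w.1 * hd
  rcases hdet.lt_or_gt with hlt | hgt
  · refine ⟨-w, neg_ne_zero.2 hw0, not_oneSidedExpansive_of_det_pos hx hy h
      (by rw [pairing_neg, hw, neg_zero]) ?_⟩
    simp only [Prod.fst_neg, Prod.snd_neg]
    push_cast
    linarith
  · exact ⟨w, hw0, not_oneSidedExpansive_of_det_pos hx hy h hw hgt⟩

/-! ### Irrational directions -/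

theorem not_halfPlane_pair_of_complexity_le_card [Finite A] [TopologicalSpace A]
    [DiscreteTopology A] {η : ℤ × ℤ → A} {s : Finset (ℤ × ℤ)}
    (hs : complexity η (s : Set (ℤ × ℤ)) ≤ s.card) {u : ℝ × ℝ}
    (hu : ∀ w, pairing u w = 0 → w = 0) {x y : ℤ × ℤ → A} (hx : x ∈ orbitClosure η)
    (hy : y ∈ orbitClosure η) : ¬ IsHalfPlanePair u x y := by
  intro h
  have hinj : Function.Injective (pairing u) := fun z w hzw =>
    sub_eq_zero.1 (hu _ (by rw [pairing_sub, hzw, sub_self]))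
  obtain ⟨p, hp, hdet⟩ := exists_determined_of_complexity_le_card η hinj hs
  obtain ⟨v, hv⟩ := exists_eq_translate (shift_mem_orbitClosure η (-p) hx) s.finite_toSet
  obtain ⟨w, hw⟩ := exists_eq_translate (shift_mem_orbitClosure η (-p) hy) s.finite_toSet
  have := hdet v w fun q hq hlt => by
    rw [← hv q hq, ← hw q hq]
    refine h.eq_of_neg _ ?_
    rw [pairing_add, pairing_neg]
    linarith
  rw [← hv p hp, ← hw p hp] at this
  simp only [shift, add_neg_cancel] at this
  exact h.apply_ne this

theorem complexity_le_card_of_rectangle {η : ℤ × ℤ → A} {n k : ℕ}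
    (h : complexity η (rectangle n k) ≤ ((n * k : ℕ) : ℕ∞)) :
    ∃ s : Finset (ℤ × ℤ), complexity η (s : Set (ℤ × ℤ)) ≤ s.card := by
  refine ⟨Finset.Ico 0 (n : ℤ) ×ˢ Finset.Ico 0 (k : ℤ), ?_⟩
  rw [Finset.coe_product, Finset.coe_Ico, Finset.coe_Ico, Finset.card_product]
  simpa [rectangle] using h

/-! ### Finite orbit closures -/

theorem finite_orbitClosure_of_not_hasNonexpansiveLine [Finite A] [TopologicalSpace A]
    [DiscreteTopology A] {η : ℤ × ℤ → A} (m : MetricSpace (orbitClosure η))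
    (hm : m.toUniformSpace.toTopologicalSpace =
      (instTopologicalSpaceSubtype : TopologicalSpace (orbitClosure η)))
    (h : ¬ HasNonexpansiveLine η m) : (orbitClosure η).Finite := by
  by_contra hX
  obtain ⟨u, x, hx, y, hy, hxy⟩ := exists_halfPlane_pair hX
  exact h ⟨orthogonalLine u, finrank_orthogonalLine hxy.ne_zero,
    not_isExpansive_of_halfPlane_pair m hm hx hy hxy⟩

theorem finite_orbitClosure_of_not_hasOneSidedNonexpansiveDirection [Finite A]
    [TopologicalSpace A] [DiscreteTopology A] {η : ℤ × ℤ → A} {n k : ℕ}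
    (hc : complexity η (rectangle n k) ≤ ((n * k : ℕ) : ℕ∞))
    (h : ¬ HasOneSidedNonexpansiveDirection η) : (orbitClosure η).Finite := by
  by_contra hX
  obtain ⟨u, x, hx, y, hy, hxy⟩ := exists_halfPlane_pair hX
  obtain ⟨s, hs⟩ := complexity_le_card_of_rectangle hc
  refine not_halfPlane_pair_of_complexity_le_card hs (fun w hw => ?_) hx hy hxy
  by_contra hw0
  exact h (exists_not_oneSidedExpansive_of_halfPlane_pair hx hy hxy hw0 hw)

theorem finite_orbit_of_finite_orbitClosure [TopologicalSpace A] {η : ℤ × ℤ → A}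
    (h : (orbitClosure η).Finite) : (orbit η).Finite := h.subset subset_closure

theorem exists_isPeriodVector_zsmul {η : ℤ × ℤ → A} (h : (orbit η).Finite) (e : ℤ × ℤ) :
    ∃ n : ℤ, n ≠ 0 ∧ IsPeriodVector η (n • e) := by
  have := h.to_subtype
  obtain ⟨i, j, hij, heq⟩ := Finite.exists_ne_map_eq_of_infinite
    fun n : ℤ => (⟨shift (n • e) η, n • e, rfl⟩ : orbit η)
  refine ⟨i - j, sub_ne_zero.2 hij, fun x => ?_⟩
  have := congrFun (congrArg Subtype.val heq) (x - j • e)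
  simp only [shift, sub_add_cancel] at this
  rw [← this, sub_smul]
  congr 1
  abel

theorem doublyPeriodic_of_finite_orbit {η : ℤ × ℤ → A} (h : (orbit η).Finite) :
    DoublyPeriodic η := by
  obtain ⟨a, ha, hpa⟩ := exists_isPeriodVector_zsmul h (1, 0)
  obtain ⟨b, hb, hpb⟩ := exists_isPeriodVector_zsmul h (0, 1)
  refine ⟨_, _, hpa, hpb, LinearIndependent.pair_iff.2 fun s t hst => ?_⟩
  simpa [ha, hb] using hst

theorem IsPeriodVector.zsmul {η : ℤ × ℤ → A} {u : ℤ × ℤ} (h : IsPeriodVector η u) (n : ℤ) :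
    IsPeriodVector η (n • u) := by
  have hn : ∀ n : ℕ, IsPeriodVector η (n • u) := fun n => by
    induction n with
    | zero => intro x; simp
    | succ n ih => intro x; rw [succ_nsmul, ← add_assoc, h, ih]
  obtain ⟨k, rfl | rfl⟩ := n.eq_nat_or_neg
  · rw [natCast_zsmul]; exact hn k
  · intro x
    have := hn k (x + -(k : ℤ) • u)
    rw [← this, neg_smul, natCast_zsmul, neg_add_cancel_right]

theorem IsPeriodVector.add {η : ℤ × ℤ → A} {u v : ℤ × ℤ} (hu : IsPeriodVector η u)
    (hv : IsPeriodVector η v) : IsPeriodVector η (u + v) := fun x => by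
  rw [← add_assoc, hv, hu]

/-- With `d` the determinant of two independent periods, Cramer's rule makes `(d, 0)` and `(0, d)`
periods, so that a translate depends only on the translation modulo `d`. -/
theorem finite_orbit_of_doublyPeriodic {η : ℤ × ℤ → A} (h : DoublyPeriodic η) :
    (orbit η).Finite := by
  obtain ⟨u, v, hu, hv, hli⟩ := h
  set d : ℤ := u.1 * v.2 - u.2 * v.1 with hd
  have hd0 : d ≠ 0 := by
    intro h0
    rw [LinearIndependent.pair_iff] at hli
    have h1 := hli v.2 (-u.2) (Prod.ext (by simp; linarith) (by simp; ring))
    have h2 := hli v.1 (-u.1) (Prod.ext (by simp; ring) (by simp; linarith))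
    have h3 := hli 1 0
    rw [neg_eq_zero] at h1 h2
    have hu0 : u = 0 := Prod.ext h2.2 h1.2
    simp [hu0] at h3
  have hp : ∀ i j : ℤ, IsPeriodVector η (i * d, j * d) := fun i j => by
    have : ((i * d, j * d) : ℤ × ℤ) =
        (i * v.2 - j * v.1) • u + (j * u.1 - i * u.2) • v := by
      ext <;> simp [hd] <;> ring
    rw [this]
    exact (hu.zsmul _).add (hv.zsmul _)
  have hfin : (Set.Ico 0 |d| ×ˢ Set.Ico 0 |d|).Finite :=
    (Set.finite_Ico _ _).prod (Set.finite_Ico _ _)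
  refine (hfin.image fun w => shift w η).subset ?_
  rintro _ ⟨w, rfl⟩
  refine ⟨(w.1 % d, w.2 % d), ⟨⟨Int.emod_nonneg _ hd0, Int.emod_lt_abs _ hd0⟩,
    ⟨Int.emod_nonneg _ hd0, Int.emod_lt_abs _ hd0⟩⟩, funext fun x => ?_⟩
  have := hp (w.1 / d) (w.2 / d) (x + (w.1 % d, w.2 % d))
  simp only [shift]
  rw [← this]
  congr 1
  ext
  · simp only [Prod.fst_add]; linarith [Int.emod_add_mul_ediv w.1 d]
  · simp only [Prod.snd_add]; linarith [Int.emod_add_mul_ediv w.2 d]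

theorem not_hasNonexpansiveLine_of_finite_orbitClosure [TopologicalSpace A] {η : ℤ × ℤ → A}
    (h : (orbitClosure η).Finite) (m : MetricSpace (orbitClosure η)) :
    ¬ HasNonexpansiveLine η m := by
  rintro ⟨V, -, hV⟩
  have := h.to_subtype
  refine hV ⟨1, one_pos, ?_⟩
  -- The least distance between distinct points serves as the expansiveness constant.
  have hpos : ∃ δ > (0 : ℝ), ∀ x y : orbitClosure η, m.dist x y < δ → x = y := by
    have hfin : {q : orbitClosure η × orbitClosure η | q.1 ≠ q.2}.Finite := Set.toFinite _
    rcases Set.eq_empty_or_nonempty {q : orbitClosure η × orbitClosure η | q.1 ≠ q.2} with he | hne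
    · refine ⟨1, one_pos, fun x y _ => ?_⟩
      by_contra hxy
      exact Set.eq_empty_iff_forall_notMem.1 he (x, y) hxy
    · obtain ⟨q, hq, hmin⟩ := Set.exists_min_image _ (fun q => m.dist q.1 q.2) hfin hne
      refine ⟨m.dist q.1 q.2, (@dist_pos _ m _ _).2 hq, fun x y hxy => ?_⟩
      by_contra hne
      exact (hmin (x, y) hne).not_gt hxy
  obtain ⟨δ, hδ, hsep⟩ := hpos
  refine ⟨δ, hδ, fun x y hxy => ?_⟩
  have h0 : toPlane 0 = 0 := by ext i; fin_cases i <;> simp [toPlane]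
  have hs : ∀ z, shiftAction η 0 z = z := fun z =>
    Subtype.ext (by funext w; simp [shiftAction, shift])
  have := hxy 0 (by rw [h0, Metric.infDist_zero_of_mem V.zero_mem]; exact one_pos)
  rw [hs, hs] at this
  exact hsep x y this

theorem complexity_le_encard_orbit (η : ℤ × ℤ → A) (S : Set (ℤ × ℤ)) :
    complexity η S ≤ (orbit η).encard := by
  have : colorings η S = (fun f (x : S) => f x.1) '' orbit η := by
    rw [orbit, ← Set.range_comp]; rfl
  rw [complexity, this]
  exact Set.encard_image_le _ _

theorem exists_finite_extendsUniquely_univ {η : ℤ × ℤ → A} (h : (orbit η).Finite) :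
    ∃ F : Set (ℤ × ℤ), F.Finite ∧ ExtendsUniquely η F Set.univ := by
  classical
  -- For each pair of distinct translates, `F` contains a site where they differ.
  let c : (ℤ × ℤ → A) × (ℤ × ℤ → A) → ℤ × ℤ := fun q =>
    if hq : ∃ z, q.1 z ≠ q.2 z then hq.choose else 0
  refine ⟨c '' (orbit η ×ˢ orbit η), (h.prod h).image c, ?_⟩
  rintro _ ⟨u, rfl⟩
  refine ⟨fun x => shift u η x, ⟨⟨u, rfl⟩, fun _ _ _ => rfl⟩, ?_⟩
  rintro _ ⟨⟨v, rfl⟩, hv⟩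
  funext x
  by_contra hne
  have hex : ∃ z, shift v η z ≠ shift u η z := ⟨x, hne⟩
  have hcz : c (shift v η, shift u η) = hex.choose := dif_pos hex
  refine hex.choose_spec (hcz ▸ hv (c (shift v η, shift u η)) ?_ trivial)
  exact ⟨(shift v η, shift u η), ⟨⟨v, rfl⟩, ⟨u, rfl⟩⟩, rfl⟩

end PlaneColoring

theorem theorem3p7 {A : Type*} [Finite A] [TopologicalSpace A] [DiscreteTopology A]
    (η : ℤ × ℤ → A)
    (m : MetricSpace (PlaneColoring.orbitClosure η))
    (hm : m.toUniformSpace.toTopologicalSpace =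
      (instTopologicalSpaceSubtype : TopologicalSpace (PlaneColoring.orbitClosure η))) :
    (PlaneColoring.DoublyPeriodic η ↔
      ∃ n k : ℕ, 1 ≤ n ∧ 1 ≤ k ∧
        PlaneColoring.complexity η (PlaneColoring.rectangle n k) ≤ ((n * k : ℕ) : ℕ∞) ∧
        ¬ PlaneColoring.HasNonexpansiveLine η m) ∧
    (∀ n k : ℕ, 1 ≤ n → 1 ≤ k →
      PlaneColoring.complexity η (PlaneColoring.rectangle n k) ≤ ((n * k : ℕ) : ℕ∞) →
      (¬ PlaneColoring.HasNonexpansiveLine η m ∨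
        ¬ PlaneColoring.HasOneSidedNonexpansiveDirection η) →
      ∃ F : Set (ℤ × ℤ), F.Finite ∧ PlaneColoring.ExtendsUniquely η F Set.univ) := by
  open PlaneColoring in
  refine ⟨⟨fun h => ?_, ?_⟩, fun n k _ _ hc h => ?_⟩
  · have hfin := finite_orbit_of_doublyPeriodic h
    have hX : (orbitClosure η).Finite := by rwa [orbitClosure, hfin.isClosed.closure_eq]
    refine ⟨(orbit η).ncard, 1, ?_, le_rfl, ?_,
      not_hasNonexpansiveLine_of_finite_orbitClosure hX m⟩
    · exact (Set.ncard_pos hfin).2 (Set.range_nonempty _)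
    · rw [mul_one, hfin.cast_ncard_eq]
      exact complexity_le_encard_orbit η _
  · rintro ⟨_, _, _, _, _, h⟩
    exact doublyPeriodic_of_finite_orbit (finite_orbit_of_finite_orbitClosure
      (finite_orbitClosure_of_not_hasNonexpansiveLine m hm h))
  · refine exists_finite_extendsUniquely_univ (finite_orbit_of_finite_orbitClosure ?_)
    rcases h with h | h
    · exact finite_orbitClosure_of_not_hasNonexpansiveLine m hm h
    · exact finite_orbitClosure_of_not_hasOneSidedNonexpansiveDirection hc h
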